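/- Conventions. A skew shape $\lambda/\mu$ is a pair of partitions $\mu\subseteq\lambda$ (rows and columns numbered from $0$, matrix orientation). $\mathrm{Tab}(\lambda/\mu)$ is the set of semistandard fillings of the squares of $\lambda/\mu$ with entries in $\mathbb N=\{0,1,2,\dots\}$: rows weakly increasing from left to right, columns strictly increasing from top to bottom. An inward jeu de taquin slide of $T\in\mathrm{Tab}(\lambda/\mu)$ into a corner $s$ of $\mu$ moves an empty square, starting at $s$: at each step the smaller of the entries to the right of and below the empty square moves into it (the lower one if they are equal), until there is no such entry; if the empty square is then $t$, the result is a tableau of shape $(\lambda\setminus\{t\})/(\mu\setminus\{s\})$. The outward slide into $t$ is the inverse operation. Two tableaux are jeu de taquin equivalent if one can be transformed into the other by a finite sequence of inward and outward slides. Two tableaux of the same shape are dual equivalent if applying any sequence of inward and outward slides (given by the squares slid into) to both of them yields two tableaux of the same shape. A tableau $\bar T\in\mathrm{Tab}(\nu/\kappa)$ is a companion tableau of $T\in\mathrm{Tab}(\chi)$ if for all $i,j\ge 0$ the number of entries $j$ in row $i$ of $T$ equals the number of entries $i$ in row $j$ of $\bar T$. The tableau $T$ is $\nu/\kappa$-dominant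 if it has a companion tableau of shape $\nu/\kappa$ (which is then unique). Corollary. Let $\chi,\chi'$ be skew shapes, let $T\in\mathrm{Tab}(\chi)$ and $T'\in\mathrm{Tab}(\chi')$ be jeu de taquin equivalent, and let $\nu/\kappa$ be a skew shape. Then $T$ is $\nu/\kappa$-dominant if and only if $T'$ is $\nu/\kappa$-dominant. In that case, the companion tableaux of $T$ and $T'$ of shape $\nu/\kappa$ are dual equivalent. -/

import Mathlib

/-- A skew shape `outer/inner`: a pair of partitions (as Young diagrams) with `inner ⊆ outer`.
Squares are pairs (row, column), numbered from 0, rows going downwards. -/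
structure SkewShape where
  outer : YoungDiagram
  inner : YoungDiagram
  inner_le : inner ≤ outer

/-- The squares of a skew shape. -/
def SkewShape.cells (χ : SkewShape) : Finset (ℕ × ℕ) :=
  χ.outer.cells \ χ.inner.cells

/-- Skew semistandard tableaux of shape `χ` with entries in `ℕ`: rows increase weakly from left to
right, columns increase strictly from top to bottom. The entry is set to `0` outside the shape, so
that equality of tableaux is equality of the fillings of the squares of `χ`. -/
@[ext]
structure SkewTab (χ : SkewShape) where
  entry : ℕ × ℕ → ℕ
  row_weak : ∀ i j j' : ℕ, j < j' → (i, j) ∈ χ.cells → (i, j') ∈ χ.cells →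
    entry (i, j) ≤ entry (i, j')
  col_strict : ∀ i i' j : ℕ, i < i' → (i, j) ∈ χ.cells → (i', j) ∈ χ.cells →
    entry (i, j) < entry (i', j)
  zeros : ∀ c : ℕ × ℕ, c ∉ χ.cells → entry c = 0

/-- A skew semistandard tableau together with its shape. -/
abbrev AnySkewTab : Type := Σ χ : SkewShape, SkewTab χ

/-- One move in an inward slide inside the diagram `lam`. A state consists of the position of the
empty square and of the current filling. Of the entries to the right of and below the empty square
the smaller one moves into it; if they are equal, the one below moves. -/
inductive HoleMove (lam : YoungDiagram) :
    (ℕ × ℕ) × (ℕ × ℕ → ℕ) → (ℕ × ℕ) × (ℕ × ℕ → ℕ) → Prop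
  | up (i j : ℕ) (f : ℕ × ℕ → ℕ) (hbelow : (i + 1, j) ∈ lam)
      (hmin : (i, j + 1) ∈ lam → f (i + 1, j) ≤ f (i, j + 1)) :
      HoleMove lam ((i, j), f) ((i + 1, j), Function.update f (i, j) (f (i + 1, j)))
  | left (i j : ℕ) (f : ℕ × ℕ → ℕ) (hright : (i, j + 1) ∈ lam)
      (hmin : (i + 1, j) ∈ lam → f (i, j + 1) < f (i + 1, j)) :
      HoleMove lam ((i, j), f) ((i, j + 1), Function.update f (i, j) (f (i, j + 1)))

/-- `T'` is the result of the inward jeu de taquin slide of `T` into the corner `s` of the inner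
partition, and this slide ends by vacating the corner `t` of the outer partition.
That `s` and `t` are corners is expressed by `inner \ {s}` and `outer \ {t}` being again Young
diagrams, namely the inner and outer partition of the new shape; in particular no square to the
right of or below `t` belongs to the diagram, so no further move is possible. -/
def IsInwardSlide (s t : ℕ × ℕ) (T T' : AnySkewTab) : Prop :=
  s ∈ T.1.inner ∧ T'.1.inner.cells = T.1.inner.cells.erase s ∧
  t ∈ T.1.outer ∧ T'.1.outer.cells = T.1.outer.cells.erase t ∧
  ∃ g : ℕ × ℕ → ℕ,
    Relation.ReflTransGen (HoleMove T.1.outer) (s, T.2.entry) (t, g) ∧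
    ∀ c ∈ T'.1.cells, T'.2.entry c = g c

/-- The two kinds of jeu de taquin slides, each with the square that the slide is into. -/
inductive JdtSlide
  | inward (s : ℕ × ℕ)
  | outward (t : ℕ × ℕ)

/-- `T'` is obtained from `T` by the given slide. The outward slide into the square `t` (a square
outside the outer partition, whose addition gives a partition) is the inverse of the inward slide
that vacates `t`. -/
def IsSlide : JdtSlide → AnySkewTab → AnySkewTab → Prop
  | .inward s, T, T' => ∃ t, IsInwardSlide s t T T'
  | .outward t, T, T' => ∃ s, IsInwardSlide s t T' T

/-- `T'` is obtained from `T` by successively performing the slides in the list. -/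
inductive IsSlideSeq : List JdtSlide → AnySkewTab → AnySkewTab → Prop
  | nil (T : AnySkewTab) : IsSlideSeq [] T T
  | cons (d : JdtSlide) (p : List JdtSlide) (T U V : AnySkewTab) :
      IsSlide d T U → IsSlideSeq p U V → IsSlideSeq (d :: p) T V

/-- Jeu de taquin equivalence: one tableau can be transformed into the other by a sequence of
inward and outward slides. -/
def JdtEquiv {χ χ' : SkewShape} (T : SkewTab χ) (T' : SkewTab χ') : Prop :=
  ∃ p : List JdtSlide, IsSlideSeq p ⟨χ, T⟩ ⟨χ', T'⟩

/-- Dual equivalence of two tableaux of the same shape: any sequence of (inward and outward) slides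
applied to both of them results in tableaux of the same shape. -/
def DualEquiv {χ : SkewShape} (T U : SkewTab χ) : Prop :=
  ∀ (p : List JdtSlide) (T' U' : AnySkewTab),
    IsSlideSeq p ⟨χ, T⟩ T' → IsSlideSeq p ⟨χ, U⟩ U' → T'.1 = U'.1

/-- The number of entries equal to `a` in row `i` of `T`. -/
def SkewTab.rowCount {χ : SkewShape} (T : SkewTab χ) (i a : ℕ) : ℕ :=
  (χ.cells.filter (fun c => c.1 = i ∧ T.entry c = a)).card

/-- `U` is a companion tableau of `T`: for all `i` and `a`, the number of entries `a` in row `i`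
of `T` equals the number of entries `i` in row `a` of `U`. -/
def IsCompanion {χ σ : SkewShape} (T : SkewTab χ) (U : SkewTab σ) : Prop :=
  ∀ i a : ℕ, T.rowCount i a = U.rowCount a i

/-- `T` is `σ`-dominant for a skew shape `σ = ν/κ`: it has a companion tableau of shape `σ`.
(This forces the weight of `T` to be `ν - κ`.) -/
def IsDominant {χ : SkewShape} (T : SkewTab χ) (σ : SkewShape) : Prop :=
  ∃ U : SkewTab σ, IsCompanion T U

/-!
Encode a tableau by its content matrix, whose entry at `(i, a)` is the number of entries `a` in row
`i`. Companionship is then transposition, and a skew shape `ν/κ` carries a tableau of given content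
iff the sums of row `i` are `ν i - κ i` and the excesses of row `i + 1` over row `i` (`rowExcess`)
are at most `κ i - κ (i + 1)`.

An inward slide acts on the content matrix by raising operators on consecutive pairs of rows: a
horizontal move of the empty square does not change row contents, and a vertical move transfers a
unit to the row above, precisely in the first column of maximal excess. Companion tableaux of jeu de
taquin equivalent tableaux are therefore connected by column raising operators. These do not change
the maximal excesses between rows or the row sums, which gives the invariance of dominance, and they
commute with the row raising operators. Hence a slide into a given square has the same number of row
steps for both companion tableaux, so their shapes remain equal, and the results are again connected
by column raising operators.
-/

open Relation
open scoped Matrix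

/-- `f` takes its maximal value `m` at `a`, and at no smaller argument. -/
structure IsFirstMax {α β : Type*} [LT α] [Preorder β] (f : α → β) (m : β) (a : α) : Prop where
  apply_eq : f a = m
  le : ∀ b, f b ≤ m
  lt : ∀ b < a, f b < m

/-- `f` takes its maximal value `m` at `a`, and at no larger argument. -/
structure IsLastMax {α β : Type*} [LT α] [Preorder β] (f : α → β) (m : β) (a : α) : Prop where
  apply_eq : f a = m
  le : ∀ b, f b ≤ m
  lt : ∀ b, a < b → f b < m

section Maxima

variable {α β : Type*} [LinearOrder α]

theorem IsFirstMax.unique [Preorder β] {f : α → β} {m m' : β} {a a' : α} (h : IsFirstMax f m a)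
    (h' : IsFirstMax f m' a') : a = a' := by
  rcases lt_trichotomy a a' with hlt | heq | hgt
  · exact absurd (h'.apply_eq ▸ h.le a') (h.apply_eq ▸ h'.lt a hlt).not_ge
  · exact heq
  · exact absurd (h.apply_eq ▸ h'.le a) (h'.apply_eq ▸ h.lt a' hgt).not_ge

theorem IsLastMax.unique [Preorder β] {f : α → β} {m m' : β} {a a' : α} (h : IsLastMax f m a)
    (h' : IsLastMax f m' a') : a = a' := by
  rcases lt_trichotomy a a' with hlt | heq | hgt
  · exact absurd (h.apply_eq ▸ h'.le a) (h'.apply_eq ▸ h.lt a' hlt).not_ge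
  · exact heq
  · exact absurd (h'.apply_eq ▸ h.le a') (h.apply_eq ▸ h'.lt a hgt).not_ge

theorem exists_isFirstMax_iff [WellFoundedLT α] [PartialOrder β] {f : α → β} {m : β} :
    (∃ a, IsFirstMax f m a) ↔ IsGreatest (Set.range f) m := by
  constructor
  · rintro ⟨a, h⟩
    exact ⟨⟨a, h.apply_eq⟩, Set.forall_mem_range.2 h.le⟩
  · rintro ⟨hm, hle⟩
    obtain ⟨a, ha, hmin⟩ := WellFounded.has_min (wellFounded_lt (α := α)) {a | f a = m} hm
    exact ⟨a, ha, Set.forall_mem_range.1 hle, fun b hb =>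
      (hle ⟨b, rfl⟩).lt_of_ne fun hbm => hmin b hbm hb⟩

theorem exists_isLastMax_iff [LocallyFiniteOrder α] [OrderBot α] [NoMaxOrder α] [PartialOrder β]
    {f : α → β} {m : β} :
    (∃ a, IsLastMax f m a) ↔
      IsGreatest (Set.range f) m ∧ ∀ᶠ a in Filter.atTop, f a < m := by
  constructor
  · rintro ⟨a, h⟩
    exact ⟨⟨⟨a, h.apply_eq⟩, Set.forall_mem_range.2 h.le⟩,
      (Filter.eventually_gt_atTop a).mono h.lt⟩
  · rintro ⟨⟨hm, hle⟩, hev⟩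
    obtain ⟨k, hk⟩ := Filter.eventually_atTop.1 hev
    have hfin : {a | f a = m}.Finite := (Set.finite_Iio k).subset fun a ha =>
      lt_of_not_ge fun hka => (hk a hka).ne ha
    obtain ⟨a, ha, hmax⟩ := Set.exists_max_image _ id hfin hm
    exact ⟨a, ha, Set.forall_mem_range.1 hle, fun b hb =>
      (hle ⟨b, rfl⟩).lt_of_ne fun hbm => (hmax b hbm).not_gt hb⟩

end Maxima

theorem isGreatest_iff_isLUB {α : Type*} [LinearOrder α] [SuccOrder α] [IsSuccArchimedean α]
    [NoMinOrder α] {s : Set α} {m : α} : IsGreatest s m ↔ IsLUB s m :=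
  ⟨IsGreatest.isLUB, fun h =>
    ⟨h.mem_of_not_isSuccPrelimit Order.not_isSuccPrelimit_of_isSuccArchimedean, h.1⟩⟩

/-- The number of entries at most `j` in row `i + 1` minus the number of entries less than `j` in
row `i`, for a tableau with `M i b` entries `b` in row `i`. The columns of a tableau of that content
are strict between these rows iff this never exceeds the shift of row `i` relative to row `i + 1`.
-/
def rowExcess (i j : ℕ) : Matrix ℕ ℕ ℤ →+ ℤ where
  toFun M := ∑ b ∈ Finset.range (j + 1), M (i + 1) b - ∑ b ∈ Finset.range j, M i b
  map_zero' := by simp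
  map_add' M N := by simp only [Matrix.add_apply, Finset.sum_add_distrib]; ring

theorem rowExcess_apply (i j : ℕ) (M : Matrix ℕ ℕ ℤ) : rowExcess i j M =
    ∑ b ∈ Finset.range (j + 1), M (i + 1) b - ∑ b ∈ Finset.range j, M i b := rfl

theorem rowExcess_single (i j a b : ℕ) (x : ℤ) :
    rowExcess i j (Matrix.single a b x) =
      (if a = i + 1 ∧ b ≤ j then x else 0) - (if a = i ∧ b < j then x else 0) := by
  simp only [rowExcess_apply, Matrix.single_apply, ite_and, Finset.sum_ite_irrel,
    Finset.sum_const_zero, Finset.sum_ite_eq, Finset.mem_range, Nat.lt_succ_iff]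

theorem rowExcess_succ_sub (i j : ℕ) (M : Matrix ℕ ℕ ℤ) :
    rowExcess i (j + 1) M - rowExcess i j M = M (i + 1) (j + 1) - M i j := by
  simp only [rowExcess_apply, Finset.sum_range_succ _ (j + 1), Finset.sum_range_succ (M i)]
  ring

theorem rowExcess_succ_sub_transpose (i j : ℕ) (M : Matrix ℕ ℕ ℤ) :
    rowExcess j (i + 1) Mᵀ - rowExcess j i Mᵀ = rowExcess i (j + 1) M - rowExcess i j M := by
  rw [rowExcess_succ_sub, rowExcess_succ_sub, Matrix.transpose_apply, Matrix.transpose_apply]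

/-- The matrix whose addition moves one unit in column `j` from row `i + 1` up to row `i`; its
transpose moves one unit in row `j` from column `i + 1` to column `i`. -/
def rowTransfer (i j : ℕ) : Matrix ℕ ℕ ℤ :=
  Matrix.single i j 1 - Matrix.single (i + 1) j 1

theorem rowTransfer_add_transpose (i j : ℕ) :
    rowTransfer i j + (rowTransfer j (i + 1))ᵀ = (rowTransfer j i)ᵀ + rowTransfer i (j + 1) := by
  simp only [rowTransfer, Matrix.transpose_sub, Matrix.transpose_single]
  abel

theorem rowExcess_rowTransfer (i j b : ℕ) :
    rowExcess i b (rowTransfer i j) = -(if j ≤ b then 1 else 0) - if j < b then 1 else 0 := by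
  simp [rowTransfer, map_sub, rowExcess_single]
  ring

theorem rowExcess_rowTransfer_transpose (i b j a : ℕ) :
    rowExcess i b (rowTransfer j a)ᵀ =
      (if a = i + 1 ∧ b = j then 1 else 0) - if a = i ∧ b = j + 1 then 1 else 0 := by
  simp only [rowTransfer, Matrix.transpose_sub, Matrix.transpose_single, map_sub, rowExcess_single]
  grind

/-- The raising operator on the rows `i` and `i + 1`, as a relation, at matrices `M` whose maximal
excess is `m + 1`: the unit is moved up in the first column where the excess is maximal. -/
def RowRaise (i : ℕ) (m : ℤ) (M M' : Matrix ℕ ℕ ℤ) : Prop :=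
  ∃ j, IsFirstMax (rowExcess i · M) (m + 1) j ∧ M' = M + rowTransfer i j

/-- The raising operator on the columns `j` and `j + 1`. -/
def ColRaise (j : ℕ) (n : ℤ) (M M' : Matrix ℕ ℕ ℤ) : Prop :=
  RowRaise j n Mᵀ M'ᵀ

/-- The upper bounds of the excesses of row `i + 1` over row `i`. -/
def excessBounds (i : ℕ) (M : Matrix ℕ ℕ ℤ) : Set ℤ :=
  upperBounds (Set.range (rowExcess i · M))

theorem mem_excessBounds {i : ℕ} {M : Matrix ℕ ℕ ℤ} {c : ℤ} :
    c ∈ excessBounds i M ↔ ∀ b, rowExcess i b M ≤ c :=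
  Set.forall_mem_range

theorem colRaise_iff {j : ℕ} {n : ℤ} {M M' : Matrix ℕ ℕ ℤ} : ColRaise j n M M' ↔
    ∃ a, IsFirstMax (rowExcess j · Mᵀ) (n + 1) a ∧ M' = M + (rowTransfer j a)ᵀ := by
  refine exists_congr fun a => and_congr_right fun _ => ?_
  rw [← Matrix.transpose_inj, Matrix.transpose_add, Matrix.transpose_transpose,
    Matrix.transpose_transpose]

theorem isLastMax_rowExcess_add_rowTransfer_iff (i j : ℕ) (m : ℤ) (M : Matrix ℕ ℕ ℤ) :
    IsLastMax (rowExcess i · (M + rowTransfer i j)) m j ↔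
      IsFirstMax (rowExcess i · M) (m + 1) j := by
  simp only [map_add, rowExcess_rowTransfer]
  constructor
  · rintro ⟨heq, hle, hlt⟩
    exact ⟨by grind, fun b => by have := hle b; have := hlt b; grind,
      fun b hb => by have := hle b; grind⟩
  · rintro ⟨heq, hle, hlt⟩
    exact ⟨by grind, fun b => by have := hle b; have := hlt b; grind,
      fun b hb => by have := hle b; grind⟩

theorem rowRaise_iff_isLastMax {i : ℕ} {m : ℤ} {M M' : Matrix ℕ ℕ ℤ} : RowRaise i m M M' ↔
    ∃ j, IsLastMax (rowExcess i · M') m j ∧ M = M' - rowTransfer i j := by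
  refine exists_congr fun j => ?_
  rw [eq_sub_iff_add_eq, eq_comm (a := M')]
  refine and_congr_left fun h => ?_
  rw [← h, isLastMax_rowExcess_add_rowTransfer_iff]

theorem RowRaise.unique {i : ℕ} {m m' : ℤ} {M M₁ M₂ : Matrix ℕ ℕ ℤ} (h₁ : RowRaise i m M M₁)
    (h₂ : RowRaise i m' M M₂) : M₁ = M₂ := by
  obtain ⟨j, hj, rfl⟩ := h₁
  obtain ⟨j', hj', rfl⟩ := h₂
  rw [hj.unique hj']

theorem RowRaise.unique_left {i : ℕ} {m m' : ℤ} {M M₁ M₂ : Matrix ℕ ℕ ℤ}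
    (h₁ : RowRaise i m M₁ M) (h₂ : RowRaise i m' M₂ M) : M₁ = M₂ := by
  obtain ⟨j, hj, rfl⟩ := rowRaise_iff_isLastMax.1 h₁
  obtain ⟨j', hj', rfl⟩ := rowRaise_iff_isLastMax.1 h₂
  rw [hj.unique hj']

theorem exists_rowRaise_iff {i : ℕ} {m : ℤ} {M : Matrix ℕ ℕ ℤ} :
    (∃ M', RowRaise i m M M') ↔ IsLeast (excessBounds i M) (m + 1) := by
  simp only [RowRaise, exists_comm (α := Matrix ℕ ℕ ℤ), exists_and_left, exists_eq, and_true,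
    exists_isFirstMax_iff, isGreatest_iff_isLUB]
  rfl

theorem exists_rowRaise_left_iff {i : ℕ} {m : ℤ} {M' : Matrix ℕ ℕ ℤ} :
    (∃ M, RowRaise i m M M') ↔
      IsLeast (excessBounds i M') m ∧ ∀ᶠ b in Filter.atTop, rowExcess i b M' < m := by
  simp only [rowRaise_iff_isLastMax, exists_comm (α := Matrix ℕ ℕ ℤ), exists_and_left, exists_eq,
    and_true, exists_isLastMax_iff, isGreatest_iff_isLUB]
  rfl

theorem ColRaise.excessBounds_eq {j : ℕ} {n : ℤ} {M N : Matrix ℕ ℕ ℤ} (h : ColRaise j n M N)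
    (i : ℕ) : excessBounds i N = excessBounds i M := by
  obtain ⟨a, ⟨heq, hle, hlt⟩, rfl⟩ := colRaise_iff.1 h
  have key := rowExcess_succ_sub_transpose i j M
  have hle₀ := hle i
  have hle₁ := hle (i + 1)
  have hlt₀ := hlt i
  ext c
  simp only [mem_excessBounds, map_add, rowExcess_rowTransfer_transpose]
  constructor <;>
  · intro hc b
    have hcb := hc b
    have hcj := hc j
    have hcj' := hc (j + 1)
    grind

theorem ColRaise.eventually_rowExcess_eq {j : ℕ} {n : ℤ} {M N : Matrix ℕ ℕ ℤ}
    (h : ColRaise j n M N) (i : ℕ) :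
    ∀ᶠ b in Filter.atTop, rowExcess i b N = rowExcess i b M := by
  obtain ⟨a, -, rfl⟩ := colRaise_iff.1 h
  filter_upwards [Filter.eventually_gt_atTop (j + 1)] with b hb
  rw [map_add, rowExcess_rowTransfer_transpose, if_neg (by omega), if_neg (by omega), sub_zero,
    add_zero]

theorem ColRaise.exists_rowRaise_iff {i j : ℕ} {m n : ℤ} {M N : Matrix ℕ ℕ ℤ}
    (h : ColRaise j n M N) : (∃ N', RowRaise i m N N') ↔ ∃ M', RowRaise i m M M' := by
  rw [_root_.exists_rowRaise_iff, _root_.exists_rowRaise_iff, h.excessBounds_eq]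

theorem ColRaise.exists_rowRaise_left_iff {i j : ℕ} {m n : ℤ} {M' N' : Matrix ℕ ℕ ℤ}
    (h : ColRaise j n M' N') : (∃ N, RowRaise i m N N') ↔ ∃ M, RowRaise i m M M' := by
  rw [_root_.exists_rowRaise_left_iff, _root_.exists_rowRaise_left_iff, h.excessBounds_eq]
  refine and_congr_right fun _ => Filter.eventually_congr ?_
  filter_upwards [h.eventually_rowExcess_eq i] with b hb
  rw [hb]

theorem isFirstMax_of_interacting {i j : ℕ} {m n : ℤ} {M : Matrix ℕ ℕ ℤ}
    (hr : IsFirstMax (rowExcess i · M) (m + 1) (j + 1))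
    (hc : IsFirstMax (rowExcess j · (M + rowTransfer i (j + 1))ᵀ) (n + 1) i) :
    IsFirstMax (rowExcess j · Mᵀ) (n + 1) (i + 1) ∧
      IsFirstMax (rowExcess i · (M + (rowTransfer j (i + 1))ᵀ)) (m + 1) j := by
  obtain ⟨r_eq, r_le, r_lt⟩ := hr
  obtain ⟨c_eq, c_le, c_lt⟩ := hc
  simp only [Matrix.transpose_add, map_add, rowExcess_rowTransfer_transpose] at c_eq c_le c_lt ⊢
  have key := rowExcess_succ_sub_transpose i j M
  have hrj : rowExcess i j M = m := by grind
  have hci : rowExcess j i Mᵀ = n := by grind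
  exact ⟨⟨by grind, fun a => by have := c_le a; grind, fun a ha => by have := c_lt a; grind⟩,
    ⟨by grind, fun b => by have := r_le b; grind, fun b hb => by have := r_lt b; grind⟩⟩

theorem isFirstMax_of_not_interacting {i j a b : ℕ} {m n : ℤ} {M : Matrix ℕ ℕ ℤ}
    (hr : IsFirstMax (rowExcess i · M) (m + 1) b)
    (hc : IsFirstMax (rowExcess j · (M + rowTransfer i b)ᵀ) (n + 1) a)
    (hab : ¬(a = i ∧ b = j + 1)) :
    IsFirstMax (rowExcess j · Mᵀ) (n + 1) a ∧
      IsFirstMax (rowExcess i · (M + (rowTransfer j a)ᵀ)) (m + 1) b := by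
  obtain ⟨r_eq, r_le, r_lt⟩ := hr
  obtain ⟨c_eq, c_le, c_lt⟩ := hc
  simp only [Matrix.transpose_add, map_add, rowExcess_rowTransfer_transpose] at c_eq c_le c_lt ⊢
  have key := rowExcess_succ_sub_transpose i j M
  have r_le₀ := r_le j
  have r_le₁ := r_le (j + 1)
  have r_lt₀ := r_lt j
  have r_lt₁ := r_lt (j + 1)
  have c_le₀ := c_le i
  have c_lt₀ := c_lt i
  refine ⟨⟨by grind, fun x => ?_, fun x hx => ?_⟩, ⟨by grind, fun y => ?_, fun y hy => ?_⟩⟩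
  · have := c_le x
    grind
  · have := c_lt x hx
    grind
  · have := r_le y
    grind
  · have := r_lt y hy
    grind

theorem RowRaise.exchange {i j : ℕ} {m n : ℤ} {M M' N' : Matrix ℕ ℕ ℤ}
    (hr : RowRaise i m M M') (hc : ColRaise j n M' N') :
    ∃ N, ColRaise j n M N ∧ RowRaise i m N N' := by
  simp only [colRaise_iff] at hc ⊢
  obtain ⟨b, hb, rfl⟩ := hr
  obtain ⟨a, ha, rfl⟩ := hc
  -- The raises interfere only if the column raise moves on the very unit that the row raise has
  -- moved to `(i, j + 1)`. In the other order the unit passes through `(i + 1, j)` instead.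
  by_cases h : a = i ∧ b = j + 1
  · obtain ⟨rfl, rfl⟩ := h
    obtain ⟨ha', hb'⟩ := isFirstMax_of_interacting hb ha
    refine ⟨_, ⟨_, ha', rfl⟩, _, hb', ?_⟩
    rw [add_assoc, add_assoc, add_comm (rowTransfer a (j + 1)), ← rowTransfer_add_transpose,
      add_comm (rowTransfer a j)]
  · obtain ⟨ha', hb'⟩ := isFirstMax_of_not_interacting hb ha h
    exact ⟨_, ⟨_, ha', rfl⟩, _, hb', add_right_comm _ _ _⟩

theorem ColRaise.exchange {i j : ℕ} {m n : ℤ} {M N N' : Matrix ℕ ℕ ℤ}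
    (hc : ColRaise j n M N) (hr : RowRaise i m N N') :
    ∃ M', RowRaise i m M M' ∧ ColRaise j n M' N' := by
  obtain ⟨P, hP, hP'⟩ := RowRaise.exchange (M' := Nᵀ) (N' := N'ᵀ) hc hr
  exact ⟨Pᵀ, hP, hP'⟩

/-- The equivalence relation generated by all column raising operators. -/
def ColEquiv : Matrix ℕ ℕ ℤ → Matrix ℕ ℕ ℤ → Prop :=
  ReflTransGen (SymmGen fun M N => ∃ j n, ColRaise j n M N)

theorem ColEquiv.symm {M N : Matrix ℕ ℕ ℤ} (h : ColEquiv M N) : ColEquiv N M :=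
  Std.Symm.symm (r := ReflTransGen _) _ _ h

theorem ColEquiv.excessBounds_eq {M N : Matrix ℕ ℕ ℤ} (h : ColEquiv M N) (i : ℕ) :
    excessBounds i N = excessBounds i M := by
  induction h with
  | refl => rfl
  | tail _ h ih =>
    obtain ⟨j, n, h⟩ | ⟨j, n, h⟩ := h
    · rw [h.excessBounds_eq, ih]
    · rw [← h.excessBounds_eq, ih]

theorem hasSum_rowTransfer_transpose (j a i : ℕ) : HasSum ((rowTransfer j a)ᵀ i) 0 := by
  have hasSum_single_row (b : ℕ) :
      HasSum (Matrix.single a b (1 : ℤ) i) (Matrix.single a b 1 i b) :=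
    hasSum_single b fun b' hb' => Matrix.single_apply_of_col_ne _ _ hb'.symm _
  have hsub := (hasSum_single_row j).sub (hasSum_single_row (j + 1))
  have hvalue : Matrix.single a j (1 : ℤ) i j - Matrix.single a (j + 1) 1 i (j + 1) = 0 := by
    simp only [Matrix.single_apply, and_true, sub_self]
  rw [rowTransfer, Matrix.transpose_sub, Matrix.transpose_single, Matrix.transpose_single]
  exact hvalue ▸ hsub

theorem ColRaise.hasSum_row_iff {j : ℕ} {n : ℤ} {M N : Matrix ℕ ℕ ℤ} (h : ColRaise j n M N)
    {i : ℕ} {s : ℤ} : HasSum (N i) s ↔ HasSum (M i) s := by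
  obtain ⟨a, -, rfl⟩ := colRaise_iff.1 h
  have hzero := hasSum_rowTransfer_transpose j a i
  refine ⟨fun hs => ?_, fun hs => add_zero s ▸ hs.add hzero⟩
  simpa only [Matrix.add_apply, add_sub_cancel_right, sub_zero] using hs.sub hzero

theorem ColEquiv.hasSum_row {M N : Matrix ℕ ℕ ℤ} (h : ColEquiv M N) {i : ℕ} {s : ℤ}
    (hM : HasSum (M i) s) : HasSum (N i) s := by
  induction h with
  | refl => exact hM
  | tail _ h ih =>
    obtain ⟨j, n, h⟩ | ⟨j, n, h⟩ := h
    · exact h.hasSum_row_iff.2 ih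
    · exact h.hasSum_row_iff.1 ih

theorem ColEquiv.exists_rowRaise {i : ℕ} {m : ℤ} {M M' N : Matrix ℕ ℕ ℤ} (h : ColEquiv M N)
    (hr : RowRaise i m M M') : ∃ N', RowRaise i m N N' ∧ ColEquiv M' N' := by
  induction h with
  | refl => exact ⟨M', hr, .refl⟩
  | tail _ h ih =>
    obtain ⟨P', hP, hMP⟩ := ih
    obtain ⟨j, n, h⟩ | ⟨j, n, h⟩ := h
    · obtain ⟨N', hN⟩ := h.exists_rowRaise_iff.2 ⟨P', hP⟩
      obtain ⟨P'', hP', hPN⟩ := h.exchange hN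
      obtain rfl := hP.unique hP'
      exact ⟨N', hN, hMP.tail (.inl ⟨j, n, hPN⟩)⟩
    · obtain ⟨N', hN, hNP⟩ := h.exchange hP
      exact ⟨N', hN, hMP.tail (.inr ⟨j, n, hNP⟩)⟩

theorem ColEquiv.exists_rowRaise_left {i : ℕ} {m : ℤ} {M M' N' : Matrix ℕ ℕ ℤ}
    (h : ColEquiv M' N') (hr : RowRaise i m M M') : ∃ N, RowRaise i m N N' ∧ ColEquiv M N := by
  induction h with
  | refl => exact ⟨M, hr, .refl⟩
  | tail _ h ih =>
    obtain ⟨P, hP, hMP⟩ := ih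
    obtain ⟨j, n, h⟩ | ⟨j, n, h⟩ := h
    · obtain ⟨N, hPN, hN⟩ := hP.exchange h
      exact ⟨N, hN, hMP.tail (.inl ⟨j, n, hPN⟩)⟩
    · obtain ⟨N, hN⟩ := h.exists_rowRaise_left_iff.1 ⟨P, hP⟩
      obtain ⟨P', hNP, hP'⟩ := hN.exchange h
      obtain rfl := hP.unique_left hP'
      exact ⟨N, hN, hMP.tail (.inr ⟨j, n, hNP⟩)⟩

/-- Raise row `i + 1` into row `i` at maximal excess `gap i + 1`, and pass on to the next row. -/
def RowStep (gap : ℕ → ℤ) (p q : ℕ × Matrix ℕ ℕ ℤ) : Prop :=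
  q.1 = p.1 + 1 ∧ RowRaise p.1 (gap p.1) p.2 q.2

theorem rightUnique_rowStep (gap : ℕ → ℤ) : Relator.RightUnique (RowStep gap) :=
  fun _ _ _ h h' => Prod.ext (h.1.trans h'.1.symm) (h.2.unique h'.2)

theorem leftUnique_rowStep (gap : ℕ → ℤ) : Relator.LeftUnique (RowStep gap) := by
  rintro ⟨i, M⟩ ⟨i', M'⟩ ⟨_, _⟩ ⟨rfl, h⟩ ⟨hi, h'⟩
  obtain rfl : i = i' := Nat.succ_injective hi
  exact Prod.ext rfl (h.unique_left h')

/-- A sequence of raises in consecutive rows, from row `p.1` down to row `q.1`: what an inward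
slide does to the matrix of row contents, see `IsInwardSlide.rowChain`. -/
def RowChain (gap : ℕ → ℤ) : ℕ × Matrix ℕ ℕ ℤ → ℕ × Matrix ℕ ℕ ℤ → Prop :=
  ReflTransGen (RowStep gap)

theorem RowChain.colEquiv_transpose {gap : ℕ → ℤ} {p q : ℕ × Matrix ℕ ℕ ℤ}
    (h : RowChain gap p q) : ColEquiv p.2ᵀ q.2ᵀ :=
  ReflTransGen.lift (fun p : ℕ × Matrix ℕ ℕ ℤ => p.2ᵀ)
    (fun p _ hpq => SymmGen.of_rel ⟨p.1, gap p.1, hpq.2⟩) _ _ h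

theorem ColEquiv.exists_rowChain {gap : ℕ → ℤ} {p q : ℕ × Matrix ℕ ℕ ℤ} {N : Matrix ℕ ℕ ℤ}
    (h : ColEquiv p.2 N) (hc : RowChain gap p q) :
    ∃ N', RowChain gap (p.1, N) (q.1, N') ∧ ColEquiv q.2 N' := by
  induction hc with
  | refl => exact ⟨N, .refl, h⟩
  | tail _ hstep ih =>
    obtain ⟨P, hP, hP'⟩ := ih
    obtain ⟨N', hN, hN'⟩ := hP'.exists_rowRaise hstep.2
    exact ⟨N', hP.tail ⟨hstep.1, hN⟩, hN'⟩

theorem ColEquiv.exists_rowChain_left {gap : ℕ → ℤ} {p q : ℕ × Matrix ℕ ℕ ℤ}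
    {N' : Matrix ℕ ℕ ℤ} (h : ColEquiv q.2 N') (hc : RowChain gap p q) :
    ∃ N, RowChain gap (p.1, N) (q.1, N') ∧ ColEquiv p.2 N := by
  induction hc using ReflTransGen.head_induction_on with
  | refl => exact ⟨N', .refl, h⟩
  | head hstep _ ih =>
    obtain ⟨P, hP, hP'⟩ := ih
    obtain ⟨N, hN, hN'⟩ := hP'.exists_rowRaise_left hstep.2
    exact ⟨N, .head (b := (_, P)) ⟨hstep.1, hN⟩ hP, hN'⟩

theorem eq_of_reflTransGen_of_terminal {α : Type*} {r : α → α → Prop} {a b c : α}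
    (hr : Relator.RightUnique r) (hab : ReflTransGen r a b) (hac : ReflTransGen r a c)
    (hb : ∀ x, ¬r b x) (hc : ∀ x, ¬r c x) : b = c := by
  rcases ReflTransGen.total_of_right_unique hr hab hac with hbc | hcb
  · exact hbc.cases_head.resolve_right fun ⟨x, hx, _⟩ => hb x hx
  · exact (hcb.cases_head.resolve_right fun ⟨x, hx, _⟩ => hc x hx).symm

theorem RowChain.unique {gap : ℕ → ℤ} {p q q' : ℕ × Matrix ℕ ℕ ℤ} (h : RowChain gap p q)
    (h' : RowChain gap p q') (hq : gap q.1 ∈ excessBounds q.1 q.2)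
    (hq' : gap q'.1 ∈ excessBounds q'.1 q'.2) : q = q' := by
  have terminal {q : ℕ × Matrix ℕ ℕ ℤ} (hq : gap q.1 ∈ excessBounds q.1 q.2) (x) :
      ¬RowStep gap q x := fun hx =>
    (lt_add_one _).not_ge ((exists_rowRaise_iff.1 ⟨x.2, hx.2⟩).2 hq)
  exact eq_of_reflTransGen_of_terminal (rightUnique_rowStep gap) h h' (terminal hq) (terminal hq')

theorem RowChain.unique_left {gap : ℕ → ℤ} {p p' q : ℕ × Matrix ℕ ℕ ℤ} (h : RowChain gap p q)
    (h' : RowChain gap p' q) (hp : ∀ i, p.1 = i + 1 → gap i - 1 ∈ excessBounds i p.2)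
    (hp' : ∀ i, p'.1 = i + 1 → gap i - 1 ∈ excessBounds i p'.2) : p = p' := by
  have initial {p : ℕ × Matrix ℕ ℕ ℤ}
      (hp : ∀ i, p.1 = i + 1 → gap i - 1 ∈ excessBounds i p.2) (x) : ¬RowStep gap x p := fun hx =>
    (sub_one_lt _).not_ge ((exists_rowRaise_left_iff.1 ⟨x.2, hx.2⟩).1.2 (hp x.1 hx.1))
  exact eq_of_reflTransGen_of_terminal (r := Function.swap (RowStep gap))
    (leftUnique_rowStep gap).flip (reflTransGen_swap.2 h) (reflTransGen_swap.2 h')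
    (initial hp) (initial hp')

theorem SkewShape.mem_cells {χ : SkewShape} {i c : ℕ} :
    (i, c) ∈ χ.cells ↔ χ.inner.rowLen i ≤ c ∧ c < χ.outer.rowLen i := by
  rw [SkewShape.cells, Finset.mem_sdiff, YoungDiagram.mem_cells, YoungDiagram.mem_cells,
    YoungDiagram.mem_iff_lt_rowLen, YoungDiagram.mem_iff_lt_rowLen, not_lt, and_comm]

theorem SkewShape.mem_cells_of_le {χ : SkewShape} {p q : ℕ × ℕ} (hp : p ∈ χ.cells) (hpq : p ≤ q)
    (hq : q ∈ χ.outer) : q ∈ χ.cells :=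
  Finset.mem_sdiff.2 ⟨hq, fun hq' => (Finset.mem_sdiff.1 hp).2 (χ.inner.isLowerSet hpq hq')⟩

theorem SkewShape.mem_outer {χ : SkewShape} {p : ℕ × ℕ} (hp : p ∈ χ.cells) : p ∈ χ.outer :=
  (Finset.mem_sdiff.1 hp).1

theorem SkewShape.ordConnected_cells (χ : SkewShape) : (χ.cells : Set (ℕ × ℕ)).OrdConnected :=
  ⟨fun _ hp _ hr _ hq =>
    mem_cells_of_le hp hq.1 (χ.outer.isLowerSet hq.2 (mem_outer hr))⟩

theorem SkewShape.rowLen_inner_le (χ : SkewShape) (i : ℕ) :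
    χ.inner.rowLen i ≤ χ.outer.rowLen i :=
  le_of_forall_lt fun _ hc =>
    YoungDiagram.mem_iff_lt_rowLen.1 (χ.inner_le (YoungDiagram.mem_iff_lt_rowLen.2 hc))

/-- The filling `f` is semistandard on a set `S` of squares that need not be a skew shape: during a
slide it is a skew shape with one square removed. -/
structure IsSemistandardOn (S : Finset (ℕ × ℕ)) (f : ℕ × ℕ → ℕ) : Prop where
  row_weak : ∀ i c c', c < c' → (i, c) ∈ S → (i, c') ∈ S → f (i, c) ≤ f (i, c')
  col_strict : ∀ i i' c, i < i' → (i, c) ∈ S → (i', c) ∈ S → f (i, c) < f (i', c)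

theorem SkewTab.isSemistandardOn {χ : SkewShape} (T : SkewTab χ) :
    IsSemistandardOn χ.cells T.entry :=
  ⟨T.row_weak, T.col_strict⟩

theorem IsSemistandardOn.mono {S S' : Finset (ℕ × ℕ)} {f : ℕ × ℕ → ℕ} (h : IsSemistandardOn S' f)
    (hS : S ⊆ S') : IsSemistandardOn S f :=
  ⟨fun i c c' hc hp hp' => h.row_weak i c c' hc (hS hp) (hS hp'),
    fun i i' c hi hp hp' => h.col_strict i i' c hi (hS hp) (hS hp')⟩

theorem IsSemistandardOn.insert_update {S : Finset (ℕ × ℕ)} {f : ℕ × ℕ → ℕ} {i c x : ℕ}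
    (h : IsSemistandardOn S f) (hleft : ∀ c' < c, (i, c') ∈ S → f (i, c') ≤ x)
    (hright : ∀ c' > c, (i, c') ∈ S → x ≤ f (i, c'))
    (habove : ∀ i' < i, (i', c) ∈ S → f (i', c) < x)
    (hbelow : ∀ i' > i, (i', c) ∈ S → x < f (i', c)) :
    IsSemistandardOn (insert (i, c) S) (Function.update f (i, c) x) := by
  obtain ⟨hrow, hcol⟩ := h
  constructor <;> simp only [Finset.mem_insert, Function.update_apply, Prod.mk.injEq] <;> grind

/-- The matrix of the row contents of a filling `f` of the set `S` of squares: its entry at `(i, a)`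
is the number of squares in row `i` that are filled with `a`. -/
def contentMatrix (S : Finset (ℕ × ℕ)) (f : ℕ × ℕ → ℕ) : Matrix ℕ ℕ ℤ :=
  ∑ p ∈ S, Matrix.single p.1 (f p) 1

theorem contentMatrix_apply (S : Finset (ℕ × ℕ)) (f : ℕ × ℕ → ℕ) (i a : ℕ) :
    contentMatrix S f i a = (S.filter fun p => p.1 = i ∧ f p = a).card := by
  simp only [contentMatrix, Matrix.sum_apply, Matrix.single_apply, Finset.sum_boole]

/-- The matrix of the row contents of a tableau. -/
def SkewTab.content {χ : SkewShape} (T : SkewTab χ) : Matrix ℕ ℕ ℤ :=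
  contentMatrix χ.cells T.entry

theorem contentMatrix_congr {S : Finset (ℕ × ℕ)} {f g : ℕ × ℕ → ℕ} (h : ∀ p ∈ S, f p = g p) :
    contentMatrix S f = contentMatrix S g :=
  Finset.sum_congr rfl fun p hp => by rw [h p hp]

theorem contentMatrix_insert {S : Finset (ℕ × ℕ)} {p : ℕ × ℕ} (hp : p ∉ S) (f : ℕ × ℕ → ℕ) :
    contentMatrix (insert p S) f = contentMatrix S f + Matrix.single p.1 (f p) 1 :=
  (Finset.sum_insert hp).trans (add_comm _ _)

theorem contentMatrix_insert_update {S : Finset (ℕ × ℕ)} {p : ℕ × ℕ} (hp : p ∉ S)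
    (f : ℕ × ℕ → ℕ) (x : ℕ) : contentMatrix (insert p S) (Function.update f p x) =
      contentMatrix S f + Matrix.single p.1 x 1 := by
  rw [contentMatrix_insert hp, Function.update_self, contentMatrix_congr]
  exact fun q hq => Function.update_of_ne (ne_of_mem_of_not_mem hq hp) _ _

/-- The columns of the squares of `S` in row `i` with an entry less than `j`. -/
def lowColumns (S : Finset (ℕ × ℕ)) (f : ℕ × ℕ → ℕ) (i j : ℕ) : Finset ℕ :=
  (S.filter fun p => p.1 = i ∧ f p < j).image Prod.snd

theorem mem_lowColumns {S : Finset (ℕ × ℕ)} {f : ℕ × ℕ → ℕ} {i j c : ℕ} :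
    c ∈ lowColumns S f i j ↔ (i, c) ∈ S ∧ f (i, c) < j := by
  simp only [lowColumns, Finset.mem_image, Finset.mem_filter, Prod.exists, exists_eq_right,
    and_left_comm, exists_eq_left]

theorem sum_range_contentMatrix (S : Finset (ℕ × ℕ)) (f : ℕ × ℕ → ℕ) (i j : ℕ) :
    ∑ a ∈ Finset.range j, contentMatrix S f i a = (lowColumns S f i j).card := by
  have hinj : Set.InjOn Prod.snd (S.filter fun p => p.1 = i ∧ f p < j : Set (ℕ × ℕ)) := by
    intro p hp q hq hpq
    simp only [Finset.coe_filter, Set.mem_ofPred_eq] at hp hq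
    exact Prod.ext (hp.2.1.trans hq.2.1.symm) hpq
  rw [lowColumns, Finset.card_image_of_injOn hinj, Finset.natCast_card_filter]
  simp only [contentMatrix, Matrix.sum_apply, Matrix.single_apply]
  rw [Finset.sum_comm]
  refine Finset.sum_congr rfl fun p _ => ?_
  simp only [ite_and, Finset.sum_ite_irrel, Finset.sum_const_zero, Finset.sum_ite_eq,
    Finset.mem_range]

theorem rowExcess_contentMatrix (i j : ℕ) (S : Finset (ℕ × ℕ)) (f : ℕ × ℕ → ℕ) :
    rowExcess i j (contentMatrix S f) =
      (lowColumns S f (i + 1) (j + 1)).card - (lowColumns S f i j).card := by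
  rw [rowExcess_apply, sum_range_contentMatrix, sum_range_contentMatrix]

/-- The shift of row `i` of a skew shape with inner partition `μ` relative to row `i + 1`. -/
def rowDrop (μ : YoungDiagram) (i : ℕ) : ℤ :=
  μ.rowLen i - μ.rowLen (i + 1)

theorem card_Ico_rowLen (μ : YoungDiagram) (i : ℕ) :
    ((Finset.Ico (μ.rowLen (i + 1)) (μ.rowLen i)).card : ℤ) = rowDrop μ i := by
  rw [Nat.card_Ico, Nat.cast_sub (μ.rowLen_anti _ _ i.le_succ), rowDrop]

theorem IsSemistandardOn.rowDrop_mem_excessBounds {θ : SkewShape} {S : Finset (ℕ × ℕ)}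
    {f : ℕ × ℕ → ℕ} {i : ℕ} (hf : IsSemistandardOn S f) (hS : S ⊆ θ.cells)
    (habove : ∀ c, (i + 1, c) ∈ S → (i, c) ∈ θ.cells → (i, c) ∈ S) :
    rowDrop θ.inner i ∈ excessBounds i (contentMatrix S f) := by
  refine mem_excessBounds.2 fun j => ?_
  have hsub : lowColumns S f (i + 1) (j + 1) ⊆
      Finset.Ico (θ.inner.rowLen (i + 1)) (θ.inner.rowLen i) ∪ lowColumns S f i j := by
    intro c hc
    rw [mem_lowColumns] at hc
    rw [Finset.mem_union, Finset.mem_Ico, mem_lowColumns]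
    have hθ := SkewShape.mem_cells.1 (hS hc.1)
    refine (lt_or_ge c (θ.inner.rowLen i)).imp (⟨hθ.1, ·⟩) fun hic => ?_
    have hic' := habove c hc.1 <|
      SkewShape.mem_cells.2 ⟨hic, hθ.2.trans_le (θ.outer.rowLen_anti _ _ i.le_succ)⟩
    exact ⟨hic', (hf.col_strict _ _ c i.lt_succ_self hic' hc.1).trans_le (Nat.le_of_lt_succ hc.2)⟩
  have hcard := (Finset.card_le_card hsub).trans (Finset.card_union_le _ _)
  rw [rowExcess_contentMatrix, ← card_Ico_rowLen, sub_le_iff_le_add]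
  exact_mod_cast hcard

theorem rowDrop_le_rowExcess {θ : SkewShape} {S : Finset (ℕ × ℕ)} {f : ℕ × ℕ → ℕ} {i j c : ℕ}
    (hS : S ⊆ θ.cells) (hc : θ.inner.rowLen i ≤ c)
    (hlow : ∀ c', (i, c') ∈ S → f (i, c') < j → c' < c)
    (hbelow : ∀ c' < c, θ.inner.rowLen (i + 1) ≤ c' → (i + 1, c') ∈ S ∧ f (i + 1, c') ≤ j) :
    rowDrop θ.inner i ≤ rowExcess i j (contentMatrix S f) := by
  have hdrop := θ.inner.rowLen_anti _ _ i.le_succ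
  have hsub : Finset.Ico (θ.inner.rowLen (i + 1)) (θ.inner.rowLen i) ∪ lowColumns S f i j ⊆
      lowColumns S f (i + 1) (j + 1) := by
    intro c' hc'
    rw [Finset.mem_union, Finset.mem_Ico, mem_lowColumns] at hc'
    rw [mem_lowColumns, Nat.lt_succ_iff]
    rcases hc' with ⟨hmin, hmax⟩ | ⟨hmem, hj⟩
    · exact hbelow c' (hmax.trans_le hc) hmin
    · exact hbelow c' (hlow c' hmem hj) (hdrop.trans (SkewShape.mem_cells.1 (hS hmem)).1)
  have hdisj : Disjoint (Finset.Ico (θ.inner.rowLen (i + 1)) (θ.inner.rowLen i))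
      (lowColumns S f i j) := Finset.disjoint_left.2 fun c' hc' hc'' =>
    (Finset.mem_Ico.1 hc').2.not_ge (SkewShape.mem_cells.1 (hS (mem_lowColumns.1 hc'').1)).1
  have hcard := Finset.card_le_card hsub
  rw [Finset.card_union_of_disjoint hdisj] at hcard
  rw [rowExcess_contentMatrix, ← card_Ico_rowLen, le_sub_iff_add_le]
  exact_mod_cast hcard

theorem SkewTab.rowDrop_mem_excessBounds {χ : SkewShape} (T : SkewTab χ) (i : ℕ) :
    rowDrop χ.inner i ∈ excessBounds i T.content :=
  T.isSemistandardOn.rowDrop_mem_excessBounds subset_rfl fun _ _ h => h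

theorem rowRaise_add_single {i x : ℕ} {m : ℤ} {B : Matrix ℕ ℕ ℤ} (hB : m ∈ excessBounds i B)
    (hx : rowExcess i x B = m) :
    RowRaise i m (B + Matrix.single (i + 1) x 1) (B + Matrix.single i x 1) := by
  rw [mem_excessBounds] at hB
  refine ⟨x, ?_, by rw [rowTransfer]; abel⟩
  simp only [map_add, rowExcess_single]
  exact ⟨by grind, fun b => by have := hB b; grind, fun b hb => by have := hB b; grind⟩

section HoleMove

variable {θ : SkewShape} {f : ℕ × ℕ → ℕ} {i c : ℕ}

theorem IsSemistandardOn.lt_below_of_lt {c' : ℕ} (hf : IsSemistandardOn (θ.cells.erase (i, c)) f)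
    (hbelow : (i + 1, c) ∈ θ.outer) (hc : c' < c) (h : (i, c') ∈ θ.cells) :
    f (i, c') < f (i + 1, c) := by
  have hbelow' : (i + 1, c) ∈ θ.cells :=
    SkewShape.mem_cells_of_le h ⟨i.le_succ, hc.le⟩ hbelow
  have hcorner : (i + 1, c') ∈ θ.cells :=
    θ.ordConnected_cells.out h hbelow' ⟨⟨i.le_succ, le_rfl⟩, ⟨le_rfl, hc.le⟩⟩
  calc f (i, c') < f (i + 1, c') :=
        hf.col_strict _ _ _ i.lt_succ_self (by simp [h, hc.ne]) (by simp [hcorner])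
    _ ≤ f (i + 1, c) := hf.row_weak _ _ _ hc (by simp [hcorner]) (by simp [hbelow'])

theorem IsSemistandardOn.below_le_of_lt {c' : ℕ} (hf : IsSemistandardOn (θ.cells.erase (i, c)) f)
    (hhole : (i, c) ∈ θ.cells) (hmin : (i, c + 1) ∈ θ.outer → f (i + 1, c) ≤ f (i, c + 1))
    (hc : c < c') (h : (i, c') ∈ θ.cells) : f (i + 1, c) ≤ f (i, c') := by
  have hright : (i, c + 1) ∈ θ.cells :=
    θ.ordConnected_cells.out hhole h ⟨⟨le_rfl, c.le_succ⟩, ⟨le_rfl, hc⟩⟩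
  refine (hmin (SkewShape.mem_outer hright)).trans ?_
  rcases (Nat.succ_le_of_lt hc).eq_or_lt with rfl | hlt
  · exact le_rfl
  · exact hf.row_weak _ _ _ hlt (by simp [hright]) (by simp [h, hc.ne'])

theorem IsSemistandardOn.up (hf : IsSemistandardOn (θ.cells.erase (i, c)) f)
    (hhole : (i, c) ∈ θ.cells) (hbelow : (i + 1, c) ∈ θ.outer)
    (hmin : (i, c + 1) ∈ θ.outer → f (i + 1, c) ≤ f (i, c + 1)) :
    IsSemistandardOn (θ.cells.erase (i + 1, c)) (Function.update f (i, c) (f (i + 1, c))) := by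
  have hnew : (i + 1, c) ∈ θ.cells.erase (i, c) := Finset.mem_erase.2
    ⟨by simp, SkewShape.mem_cells_of_le hhole ⟨i.le_succ, le_rfl⟩ hbelow⟩
  rw [← Finset.insert_erase (a := (i, c)) (s := θ.cells.erase (i + 1, c)) (by simp [hhole]),
    Finset.erase_right_comm]
  refine (hf.mono (Finset.erase_subset _ _)).insert_update
    (fun c' hc h => ?_) (fun c' hc h => ?_) (fun i' hi h => ?_) (fun i' hi h => ?_) <;>
    rw [Finset.mem_erase] at h
  · exact (hf.lt_below_of_lt hbelow hc (Finset.mem_of_mem_erase h.2)).le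
  · exact hf.below_le_of_lt hhole hmin hc (Finset.mem_of_mem_erase h.2)
  · exact hf.col_strict _ _ _ (Nat.lt_succ_of_lt hi) h.2 hnew
  · have hi' : i + 1 < i' := lt_of_le_of_ne hi fun heq => h.1 (by rw [heq])
    exact hf.col_strict _ _ _ hi' hnew h.2

theorem IsSemistandardOn.left (hf : IsSemistandardOn (θ.cells.erase (i, c)) f)
    (hhole : (i, c) ∈ θ.cells) (hright : (i, c + 1) ∈ θ.outer)
    (hmin : (i + 1, c) ∈ θ.outer → f (i, c + 1) < f (i + 1, c)) :
    IsSemistandardOn (θ.cells.erase (i, c + 1)) (Function.update f (i, c) (f (i, c + 1))) := by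
  have hnew : (i, c + 1) ∈ θ.cells.erase (i, c) := Finset.mem_erase.2
    ⟨by simp, SkewShape.mem_cells_of_le hhole ⟨le_rfl, c.le_succ⟩ hright⟩
  rw [← Finset.insert_erase (a := (i, c)) (s := θ.cells.erase (i, c + 1)) (by simp [hhole]),
    Finset.erase_right_comm]
  refine (hf.mono (Finset.erase_subset _ _)).insert_update
    (fun c' hc h => ?_) (fun c' hc h => ?_) (fun i' hi h => ?_) (fun i' hi h => ?_) <;>
    rw [Finset.mem_erase] at h
  · exact hf.row_weak _ _ _ (Nat.lt_succ_of_lt hc) h.2 hnew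
  · have hc' : c + 1 < c' := lt_of_le_of_ne hc fun heq => h.1 (by rw [heq])
    exact hf.row_weak _ _ _ hc' hnew h.2
  · have hcorner : (i', c + 1) ∈ θ.cells.erase (i, c) := Finset.mem_erase.2 ⟨by simp,
      θ.ordConnected_cells.out (Finset.mem_of_mem_erase h.2) (Finset.mem_of_mem_erase hnew)
        ⟨⟨le_rfl, c.le_succ⟩, ⟨hi.le, le_rfl⟩⟩⟩
    exact (hf.row_weak _ _ _ c.lt_succ_self h.2 hcorner).trans_lt
      (hf.col_strict _ _ _ hi hcorner hnew)
  · have hbelow : (i + 1, c) ∈ θ.cells.erase (i, c) := Finset.mem_erase.2 ⟨by simp,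
      θ.ordConnected_cells.out hhole (Finset.mem_of_mem_erase h.2)
        ⟨⟨i.le_succ, le_rfl⟩, ⟨hi, le_rfl⟩⟩⟩
    refine (hmin (SkewShape.mem_outer (Finset.mem_of_mem_erase hbelow))).trans_le ?_
    rcases (Nat.succ_le_of_lt hi).eq_or_lt with rfl | hlt
    · exact le_rfl
    · exact (hf.col_strict _ _ _ hlt hbelow h.2).le

theorem contentMatrix_erase_update {S : Finset (ℕ × ℕ)} {p q : ℕ × ℕ} (hp : p ∈ S) (hpq : p ≠ q)
    (f : ℕ × ℕ → ℕ) (x : ℕ) : contentMatrix (S.erase q) (Function.update f p x) =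
      contentMatrix ((S.erase p).erase q) f + Matrix.single p.1 x 1 := by
  rw [← contentMatrix_insert_update (by simp), Finset.erase_right_comm,
    Finset.insert_erase (Finset.mem_erase.2 ⟨hpq, hp⟩)]

theorem contentMatrix_eq_erase_add {S : Finset (ℕ × ℕ)} {p : ℕ × ℕ} (hp : p ∈ S)
    (f : ℕ × ℕ → ℕ) :
    contentMatrix S f = contentMatrix (S.erase p) f + Matrix.single p.1 (f p) 1 := by
  rw [← contentMatrix_insert (by simp), Finset.insert_erase hp]

theorem IsSemistandardOn.rowRaise_up (hf : IsSemistandardOn (θ.cells.erase (i, c)) f)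
    (hhole : (i, c) ∈ θ.cells) (hbelow : (i + 1, c) ∈ θ.outer)
    (hmin : (i, c + 1) ∈ θ.outer → f (i + 1, c) ≤ f (i, c + 1)) :
    RowRaise i (rowDrop θ.inner i) (contentMatrix (θ.cells.erase (i, c)) f)
      (contentMatrix (θ.cells.erase (i + 1, c))
        (Function.update f (i, c) (f (i + 1, c)))) := by
  have hnew : (i + 1, c) ∈ θ.cells :=
    SkewShape.mem_cells_of_le hhole ⟨i.le_succ, le_rfl⟩ hbelow
  have hhole' := (SkewShape.mem_cells.1 hhole).1
  have hsub : (θ.cells.erase (i, c)).erase (i + 1, c) ⊆ θ.cells :=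
    (Finset.erase_subset _ _).trans (Finset.erase_subset _ _)
  rw [contentMatrix_erase_update hhole (by simp),
    contentMatrix_eq_erase_add (p := (i + 1, c)) (by simp [hnew])]
  have hbounds : rowDrop θ.inner i ∈
      excessBounds i (contentMatrix ((θ.cells.erase (i, c)).erase (i + 1, c)) f) :=
    (hf.mono (Finset.erase_subset _ _)).rowDrop_mem_excessBounds hsub fun c' hc' h => by
      simpa [h] using Finset.ne_of_mem_erase hc'
  refine rowRaise_add_single hbounds (le_antisymm (mem_excessBounds.1 hbounds _) ?_)
  refine rowDrop_le_rowExcess hsub hhole' (fun c' h hlt => ?_) fun c' hc hmin' => ?_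
  · by_contra! hc
    rw [Finset.mem_erase, Finset.mem_erase] at h
    refine (hf.below_le_of_lt hhole hmin (hc.lt_of_ne ?_) h.2.2).not_gt hlt
    rintro rfl
    exact h.2.1 rfl
  · have hmem : (i + 1, c') ∈ θ.cells :=
      SkewShape.mem_cells.2 ⟨hmin', hc.trans (SkewShape.mem_cells.1 hnew).2⟩
    exact ⟨by simp [hmem, hc.ne], hf.row_weak _ _ _ hc (by simp [hmem]) (by simp [hnew])⟩

theorem contentMatrix_left (f : ℕ × ℕ → ℕ) {S : Finset (ℕ × ℕ)} (hhole : (i, c) ∈ S)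
    (hnew : (i, c + 1) ∈ S) :
    contentMatrix (S.erase (i, c + 1)) (Function.update f (i, c) (f (i, c + 1))) =
      contentMatrix (S.erase (i, c)) f := by
  rw [contentMatrix_erase_update hhole (by simp),
    contentMatrix_eq_erase_add (p := (i, c + 1)) (S := S.erase _) (by simp [hnew])]

end HoleMove

theorem HoleMove.rowChain {θ : SkewShape} {x y : (ℕ × ℕ) × (ℕ × ℕ → ℕ)}
    (hxy : ReflTransGen (HoleMove θ.outer) x y) (hx : x.1 ∈ θ.cells)
    (hf : IsSemistandardOn (θ.cells.erase x.1) x.2) :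
    RowChain (rowDrop θ.inner) (x.1.1, contentMatrix (θ.cells.erase x.1) x.2)
      (y.1.1, contentMatrix (θ.cells.erase y.1) y.2) := by
  induction hxy using ReflTransGen.head_induction_on with
  | refl => exact .refl
  | head hstep _ ih =>
    cases hstep with
    | up i c f hbelow hmin =>
      exact .head (b := (i + 1, _)) ⟨rfl, hf.rowRaise_up hx hbelow hmin⟩ <|
        ih (SkewShape.mem_cells_of_le hx ⟨i.le_succ, le_rfl⟩ hbelow) (hf.up hx hbelow hmin)
    | left i c f hright hmin =>
      have hnew : (i, c + 1) ∈ θ.cells :=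
        SkewShape.mem_cells_of_le hx ⟨le_rfl, c.le_succ⟩ hright
      simpa only [contentMatrix_left f hx hnew] using ih hnew (hf.left hx hright hmin)

theorem IsInwardSlide.rowChain {s t : ℕ × ℕ} {T T' : AnySkewTab} (h : IsInwardSlide s t T T') :
    RowChain (rowDrop T'.1.inner) (s.1, T.2.content) (t.1, T'.2.content) := by
  obtain ⟨hs, hinner, -, houter, g, hmoves, hT'⟩ := h
  have hle : T'.1.inner.cells ⊆ T.1.inner.cells := hinner ▸ Finset.erase_subset _ _
  let θ : SkewShape := ⟨T.1.outer, T'.1.inner, fun _ hp => T.1.inner_le (hle hp)⟩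
  have hhole : s ∈ θ.cells := Finset.mem_sdiff.2 ⟨T.1.inner_le hs, by simp [hinner, θ]⟩
  have hT : θ.cells.erase s = T.1.cells := by
    have : s ∉ T.1.cells := fun h => (Finset.mem_sdiff.1 h).2 hs
    grind [SkewShape.cells]
  have hg : θ.cells.erase t = T'.1.cells := by
    simp only [θ, SkewShape.cells, houter, Finset.erase_sdiff_comm]
  have hchain := HoleMove.rowChain (θ := θ) hmoves hhole (hT ▸ T.2.isSemistandardOn)
  rw [hT, hg] at hchain
  rwa [SkewTab.content, SkewTab.content, contentMatrix_congr hT']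

theorem hasSum_contentMatrix (χ : SkewShape) (f : ℕ × ℕ → ℕ) (i : ℕ) :
    HasSum (contentMatrix χ.cells f i) (χ.outer.rowLen i - χ.inner.rowLen i) := by
  have hlt {p : ℕ × ℕ} (hp : p ∈ χ.cells) : f p < χ.cells.sup f + 1 :=
    Nat.lt_succ_of_le (Finset.le_sup hp)
  have hlow : lowColumns χ.cells f i (χ.cells.sup f + 1) =
      Finset.Ico (χ.inner.rowLen i) (χ.outer.rowLen i) := by
    ext c
    rw [mem_lowColumns, Finset.mem_Ico, ← SkewShape.mem_cells, and_iff_left_of_imp hlt]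
  have hsum := sum_range_contentMatrix χ.cells f i (χ.cells.sup f + 1)
  rw [hlow, Nat.card_Ico, Nat.cast_sub (χ.rowLen_inner_le i)] at hsum
  rw [← hsum]
  refine hasSum_sum_of_ne_finset_zero fun a ha => ?_
  rw [contentMatrix_apply, Nat.cast_eq_zero, Finset.card_eq_zero, Finset.filter_eq_empty_iff]
  rintro p hp ⟨-, rfl⟩
  exact ha (Finset.mem_range.2 (hlt hp))

section Reconstruction

variable {σ : SkewShape} {N : Matrix ℕ ℕ ℕ}

/-- The column where the entries of row `a` reach `i`, for the filling of `σ` by weakly increasing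
rows that has `N a k` entries `k` in row `a`. -/
def rowBreak (σ : SkewShape) (N : Matrix ℕ ℕ ℕ) (a i : ℕ) : ℕ :=
  σ.inner.rowLen a + ∑ k ∈ Finset.range i, N a k

theorem monotone_rowBreak (σ : SkewShape) (N : Matrix ℕ ℕ ℕ) (a : ℕ) :
    Monotone (rowBreak σ N a) := fun _ _ h =>
  Nat.add_le_add_left (Finset.sum_le_sum_of_subset (Finset.range_subset_range.2 h)) _

theorem eventually_rowBreak_eq {a : ℕ}
    (hsum : HasSum (N.map Nat.cast a) (σ.outer.rowLen a - σ.inner.rowLen a : ℤ)) :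
    ∀ᶠ i in Filter.atTop, rowBreak σ N a i = σ.outer.rowLen a := by
  have htendsto := hsum.tendsto_sum_nat
  rw [nhds_discrete, Filter.tendsto_pure] at htendsto
  filter_upwards [htendsto] with i hi
  simp only [Matrix.map_apply] at hi
  rw [rowBreak]
  zify
  rw [hi, add_sub_cancel]

theorem rowBreak_le_rowLen {a : ℕ}
    (hsum : HasSum (N.map Nat.cast a) (σ.outer.rowLen a - σ.inner.rowLen a : ℤ)) (i : ℕ) :
    rowBreak σ N a i ≤ σ.outer.rowLen a :=
  (monotone_rowBreak σ N a).ge_of_tendsto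
    (tendsto_nhds_of_eventually_eq (eventually_rowBreak_eq hsum)) i

theorem rowBreak_succ_le {a : ℕ}
    (hN : rowDrop σ.inner a ∈ excessBounds a (N.map Nat.cast)) (i : ℕ) :
    rowBreak σ N (a + 1) (i + 1) ≤ rowBreak σ N a i := by
  have hi := mem_excessBounds.1 hN i
  simp only [rowExcess_apply, rowDrop, Matrix.map_apply] at hi
  rw [rowBreak, rowBreak]
  zify
  linarith

/-- The filling of `σ` by weakly increasing rows that has `N a k` entries `k` in row `a`. -/
noncomputable def rowFilling (σ : SkewShape) (N : Matrix ℕ ℕ ℕ) (p : ℕ × ℕ) : ℕ :=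
  if p ∈ σ.cells then sInf {k | p.2 < rowBreak σ N p.1 (k + 1)} else 0

theorem rowFilling_lt_iff {a c i : ℕ}
    (hsum : HasSum (N.map Nat.cast a) (σ.outer.rowLen a - σ.inner.rowLen a : ℤ))
    (hc : (a, c) ∈ σ.cells) : rowFilling σ N (a, c) < i ↔ c < rowBreak σ N a i := by
  obtain ⟨hmin, hmax⟩ := SkewShape.mem_cells.1 hc
  have hnonempty : {k | c < rowBreak σ N a (k + 1)}.Nonempty := by
    obtain ⟨k, hk⟩ := (eventually_rowBreak_eq hsum).exists
    exact ⟨k, hmax.trans_le (hk ▸ monotone_rowBreak σ N a k.le_succ)⟩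
  rw [rowFilling, if_pos hc]
  constructor
  · exact fun h => (Nat.sInf_mem hnonempty).trans_le (monotone_rowBreak σ N a h)
  · intro h
    cases i with
    | zero => exact absurd h (by simpa [rowBreak] using hmin)
    | succ k => exact Nat.lt_succ_of_le (Nat.sInf_le h)

theorem isSemistandardOn_rowFilling
    (hN : ∀ a, rowDrop σ.inner a ∈ excessBounds a (N.map Nat.cast))
    (hsum : ∀ a, HasSum (N.map Nat.cast a) (σ.outer.rowLen a - σ.inner.rowLen a : ℤ)) :
    IsSemistandardOn σ.cells (rowFilling σ N) := by
  refine ⟨fun a c c' hc h h' => ?_, fun a a' c ha h h' => ?_⟩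
  · refine Nat.le_of_lt_succ ((rowFilling_lt_iff (hsum a) h).2 (hc.trans ?_))
    exact (rowFilling_lt_iff (hsum a) h').1 (Nat.lt_succ_self _)
  · have hcolumn : {a | (a, c) ∈ σ.cells}.OrdConnected :=
      σ.ordConnected_cells.preimage_mono fun _ _ h => ⟨h, le_rfl⟩
    refine strictMonoOn_of_lt_succ hcolumn (f := fun a => rowFilling σ N (a, c))
      (fun b _ hb hb' => ?_) h h' ha
    exact (rowFilling_lt_iff (hsum b) hb).2 <|
      ((rowFilling_lt_iff (hsum (b + 1)) hb').1 (Nat.lt_succ_self _)).trans_le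
        (rowBreak_succ_le (hN b) _)

theorem contentMatrix_rowFilling
    (hsum : ∀ a, HasSum (N.map Nat.cast a) (σ.outer.rowLen a - σ.inner.rowLen a : ℤ)) :
    contentMatrix σ.cells (rowFilling σ N) = N.map Nat.cast := by
  have hlow (a i : ℕ) : lowColumns σ.cells (rowFilling σ N) a i =
      Finset.Ico (σ.inner.rowLen a) (rowBreak σ N a i) := by
    ext c
    rw [mem_lowColumns, and_congr_right (rowFilling_lt_iff (hsum a)), SkewShape.mem_cells,
      Finset.mem_Ico, and_assoc]
    exact and_congr_right fun _ =>
      and_iff_right_of_imp fun h => h.trans_le (rowBreak_le_rowLen (hsum a) i)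
  have hpartial (a i : ℕ) : ∑ k ∈ Finset.range i, contentMatrix σ.cells (rowFilling σ N) a k =
      ∑ k ∈ Finset.range i, (N a k : ℤ) := by
    rw [sum_range_contentMatrix, hlow, Nat.card_Ico, rowBreak, Nat.add_sub_cancel_left,
      Nat.cast_sum]
  ext a i
  have hi := hpartial a (i + 1)
  rwa [Finset.sum_range_succ, Finset.sum_range_succ, hpartial, add_right_inj] at hi

theorem exists_skewTab_content_eq
    (hN : ∀ a, rowDrop σ.inner a ∈ excessBounds a (N.map Nat.cast))
    (hsum : ∀ a, HasSum (N.map Nat.cast a) (σ.outer.rowLen a - σ.inner.rowLen a : ℤ)) :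
    ∃ U : SkewTab σ, U.content = N.map Nat.cast :=
  have hss := isSemistandardOn_rowFilling hN hsum
  ⟨⟨rowFilling σ N, hss.row_weak, hss.col_strict, fun _ hp => if_neg hp⟩,
    contentMatrix_rowFilling hsum⟩

end Reconstruction

theorem SkewTab.content_apply {χ : SkewShape} (T : SkewTab χ) (i a : ℕ) :
    T.content i a = T.rowCount i a :=
  contentMatrix_apply _ _ _ _

theorem isCompanion_iff {χ σ : SkewShape} {T : SkewTab χ} {U : SkewTab σ} :
    IsCompanion T U ↔ U.content = T.contentᵀ := by
  simp only [IsCompanion, ← Matrix.ext_iff, Matrix.transpose_apply, SkewTab.content_apply,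
    Nat.cast_inj]
  rw [forall_comm]
  simp only [eq_comm]

theorem isDominant_iff {χ σ : SkewShape} {T : SkewTab χ} :
    IsDominant T σ ↔ (∀ a, rowDrop σ.inner a ∈ excessBounds a T.contentᵀ) ∧
      ∀ a, HasSum (T.contentᵀ a) (σ.outer.rowLen a - σ.inner.rowLen a) := by
  simp only [IsDominant, isCompanion_iff]
  constructor
  · rintro ⟨U, hU⟩
    rw [← hU]
    exact ⟨U.rowDrop_mem_excessBounds, hasSum_contentMatrix σ U.entry⟩
  · rintro ⟨hbound, hsum⟩
    have hcast : T.contentᵀ = (Matrix.of fun a i => T.rowCount i a).map Nat.cast := by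
      ext a i
      exact T.content_apply i a
    rw [hcast] at hbound hsum ⊢
    exact exists_skewTab_content_eq hbound hsum

section EraseCorner

variable {μ μ' : YoungDiagram} {s : ℕ × ℕ}

theorem lt_rowLen_iff_of_cells_eq_erase (h : μ'.cells = μ.cells.erase s) {i c : ℕ} :
    c < μ'.rowLen i ↔ (i, c) ≠ s ∧ c < μ.rowLen i := by
  rw [← YoungDiagram.mem_iff_lt_rowLen, ← YoungDiagram.mem_iff_lt_rowLen,
    ← YoungDiagram.mem_cells, h, Finset.mem_erase, YoungDiagram.mem_cells]

theorem rowLen_fst_of_cells_eq_erase (hs : s ∈ μ) (h : μ'.cells = μ.cells.erase s) :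
    μ'.rowLen s.1 = s.2 := by
  have hmem : s.2 < μ.rowLen s.1 := YoungDiagram.mem_iff_lt_rowLen.1 hs
  have hiff {c : ℕ} : c < μ'.rowLen s.1 ↔ c ≠ s.2 ∧ c < μ.rowLen s.1 := by
    rw [lt_rowLen_iff_of_cells_eq_erase h, ne_eq, Prod.ext_iff, and_iff_right rfl]
  refine le_antisymm (not_lt.1 fun hlt => (hiff.1 hlt).1 rfl) (not_lt.1 fun hlt => ?_)
  exact (hiff.2 ⟨hlt.ne, hlt.trans hmem⟩).false

theorem rowLen_fst_eq_succ_of_cells_eq_erase (hs : s ∈ μ) (h : μ'.cells = μ.cells.erase s) :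
    μ.rowLen s.1 = s.2 + 1 := by
  refine le_antisymm (not_lt.1 fun hlt => ?_) (YoungDiagram.mem_iff_lt_rowLen.1 hs)
  have hmem := (lt_rowLen_iff_of_cells_eq_erase h).2 ⟨by simp [Prod.ext_iff], hlt⟩
  rw [rowLen_fst_of_cells_eq_erase hs h] at hmem
  exact hmem.not_ge s.2.le_succ

theorem rowLen_of_cells_eq_erase_of_ne (h : μ'.cells = μ.cells.erase s) {i : ℕ} (hi : i ≠ s.1) :
    μ'.rowLen i = μ.rowLen i :=
  eq_of_forall_lt_iff fun _ => (lt_rowLen_iff_of_cells_eq_erase h).trans <|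
    and_iff_right fun hcell => hi (congrArg Prod.fst hcell)

end EraseCorner

theorem SkewShape.ext_cells {χ χ' : SkewShape} (houter : χ.outer.cells = χ'.outer.cells)
    (hinner : χ.inner.cells = χ'.inner.cells) : χ = χ' := by
  cases χ
  cases χ'
  congr
  exacts [YoungDiagram.ext houter, YoungDiagram.ext hinner]

theorem IsInwardSlide.rowDrop_sub_one_mem_excessBounds {s t : ℕ × ℕ} {T T' : AnySkewTab}
    (h : IsInwardSlide s t T T') {i : ℕ} (hi : s.1 = i + 1) :
    rowDrop T'.1.inner i - 1 ∈ excessBounds i T.2.content := by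
  have hrow : T'.1.inner.rowLen i = T.1.inner.rowLen i :=
    rowLen_of_cells_eq_erase_of_ne h.2.1 (by lia)
  have hnext : T.1.inner.rowLen (i + 1) = T'.1.inner.rowLen (i + 1) + 1 := by
    rw [← hi, rowLen_fst_eq_succ_of_cells_eq_erase h.1 h.2.1,
      rowLen_fst_of_cells_eq_erase h.1 h.2.1]
  convert T.2.rowDrop_mem_excessBounds i using 1
  rw [rowDrop, rowDrop, hrow, hnext]
  push_cast
  ring

section TwoSlides

variable {s s' t t' : ℕ × ℕ} {U U' V V' : AnySkewTab}

theorem IsInwardSlide.colEquiv (hU : IsInwardSlide s t U U') (hV : IsInwardSlide s t' V V')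
    (hshape : U.1 = V.1) (h : ColEquiv U.2.content V.2.content) :
    U'.1 = V'.1 ∧ ColEquiv U'.2.content V'.2.content := by
  have hinner : U'.1.inner = V'.1.inner := YoungDiagram.ext (by rw [hU.2.1, hV.2.1, hshape])
  obtain ⟨N, hchain, hN⟩ := h.exists_rowChain hU.rowChain
  have hend : (t.1, N) = (t'.1, V'.2.content) :=
    hchain.unique (hinner ▸ hV.rowChain)
      (hN.excessBounds_eq _ ▸ U'.2.rowDrop_mem_excessBounds _)
      (hinner ▸ V'.2.rowDrop_mem_excessBounds _)
  obtain ⟨hrow, rfl⟩ := Prod.mk.inj hend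
  have ht : t = t' := Prod.ext hrow <| Nat.add_right_cancel (m := 1) <| by
    rw [← rowLen_fst_eq_succ_of_cells_eq_erase hU.2.2.1 hU.2.2.2.1, hrow, hshape,
      rowLen_fst_eq_succ_of_cells_eq_erase hV.2.2.1 hV.2.2.2.1]
  refine ⟨SkewShape.ext_cells ?_ (congrArg _ hinner), hN⟩
  rw [hU.2.2.2.1, hV.2.2.2.1, hshape, ht]

theorem IsInwardSlide.colEquiv_left (hU : IsInwardSlide s t U U') (hV : IsInwardSlide s' t V V')
    (hshape : U'.1 = V'.1) (h : ColEquiv U'.2.content V'.2.content) :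
    U.1 = V.1 ∧ ColEquiv U.2.content V.2.content := by
  obtain ⟨N, hchain, hN⟩ := h.exists_rowChain_left hU.rowChain
  have hstart : (s.1, N) = (s'.1, V.2.content) :=
    hchain.unique_left (by rw [congrArg SkewShape.inner hshape]; exact hV.rowChain)
      (fun _ hi => hN.excessBounds_eq _ ▸ hU.rowDrop_sub_one_mem_excessBounds hi)
      (fun _ hi => by rw [hshape]; exact hV.rowDrop_sub_one_mem_excessBounds hi)
  obtain ⟨hrow, rfl⟩ := Prod.mk.inj hstart
  have hs : s = s' := Prod.ext hrow <| by
    rw [← rowLen_fst_of_cells_eq_erase hU.1 hU.2.1, hrow, hshape,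
      rowLen_fst_of_cells_eq_erase hV.1 hV.2.1]
  refine ⟨SkewShape.ext_cells ?_ ?_, hN⟩
  · exact Finset.erase_injOn' t hU.2.2.1 hV.2.2.1 <| by
      dsimp only
      rw [← hU.2.2.2.1, ← hV.2.2.2.1, hshape]
  · exact Finset.erase_injOn' s hU.1 (hs ▸ hV.1) <| by
      dsimp only
      rw [← hU.2.1, hs, ← hV.2.1, hshape]

end TwoSlides

theorem IsSlideSeq.shape_eq {p : List JdtSlide} {U V U' V' : AnySkewTab}
    (hU : IsSlideSeq p U U') (hV : IsSlideSeq p V V') (hshape : U.1 = V.1)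
    (h : ColEquiv U.2.content V.2.content) : U'.1 = V'.1 := by
  induction hU generalizing V with
  | nil =>
    cases hV
    exact hshape
  | cons d p U W U' hslide _ ih =>
    obtain - | ⟨_, _, _, X, _, hslide', hV⟩ := hV
    suffices W.1 = X.1 ∧ ColEquiv W.2.content X.2.content from ih hV this.1 this.2
    cases d with
    | inward s =>
      obtain ⟨⟨t, hW⟩, ⟨t', hX⟩⟩ := hslide, hslide'
      exact hW.colEquiv hX hshape h
    | outward t =>
      obtain ⟨⟨s, hW⟩, ⟨s', hX⟩⟩ := hslide, hslide'
      exact hW.colEquiv_left hX hshape h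

theorem DualEquiv.of_colEquiv {σ : SkewShape} {U V : SkewTab σ}
    (h : ColEquiv U.content V.content) : DualEquiv U V :=
  fun _ _ _ hU hV => hU.shape_eq hV rfl h

theorem IsSlideSeq.colEquiv_transpose {p : List JdtSlide} {T T' : AnySkewTab}
    (h : IsSlideSeq p T T') : ColEquiv T.2.contentᵀ T'.2.contentᵀ := by
  induction h with
  | nil => exact .refl
  | cons d _ T U V hslide _ ih =>
    refine ReflTransGen.trans ?_ ih
    cases d with
    | inward s =>
      obtain ⟨t, h⟩ := hslide
      exact h.rowChain.colEquiv_transpose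
    | outward t =>
      obtain ⟨s, h⟩ := hslide
      exact h.rowChain.colEquiv_transpose.symm

theorem IsDominant.of_colEquiv {χ χ' σ : SkewShape} {T : SkewTab χ} {T' : SkewTab χ'}
    (hT : IsDominant T σ) (h : ColEquiv T.contentᵀ T'.contentᵀ) : IsDominant T' σ := by
  rw [isDominant_iff] at hT ⊢
  exact ⟨fun a => h.excessBounds_eq a ▸ hT.1 a, fun a => h.hasSum_row (hT.2 a)⟩

theorem mainTheorem7 {χ χ' : SkewShape} (T : SkewTab χ) (T' : SkewTab χ')
    (hTT' : JdtEquiv T T') (σ : SkewShape) :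
    (IsDominant T σ ↔ IsDominant T' σ) ∧
      (IsDominant T σ →
        ∀ U U' : SkewTab σ, IsCompanion T U → IsCompanion T' U' → DualEquiv U U') := by
  obtain ⟨p, hp⟩ := hTT'
  have h : ColEquiv T.contentᵀ T'.contentᵀ := hp.colEquiv_transpose
  refine ⟨⟨(.of_colEquiv · h), (.of_colEquiv · h.symm)⟩, fun _ U U' hU hU' => .of_colEquiv ?_⟩
  rwa [isCompanion_iff.1 hU, isCompanion_iff.1 hU']
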